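/- Let $\mathbb{N}=\{1,2,\dots\}$. A sequence $a:\mathbb{N}\to\mathbb{R}$ is called scattered if for every $\delta\in(0,1]$ there exists $\epsilon>0$ such that for every sufficiently large $N$, $$\frac1{N^2}\sum_{1\le m<n\le N}\min\big(|a(n)-a(m)|^{-\delta},1\big)\le\frac1{(\log N)^{1+\epsilon}},$$ where the minimum is taken to be $1$ when $a(n)=a(m)$. A sequence $(x_n)_{n\in\mathbb{N}}$ in $\mathbb{R}^k$ is uniformly distributed in $\mathbb{T}^k$ if for all intervals $I_1,\dots,I_k\subset[0,1]$ the limit $\lim_{N\to\infty}\frac1N\big|\{n\in\{1,\dots,N\}:\{x_n\}\in I_1\times\cdots\times I_k\}\big|$ exists and equals the Lebesgue measure of $I_1\times\cdots\times I_k$, where $\{x_n\}$ is the vector of the fractional parts of the coordinates of $x_n$. Let $f,g:\mathbb{R}\to\mathbb{R}$ be non-constant real-analytic functions such that $g(\mathbb{R})\subset(1,\infty)$, let $a,b:\mathbb{N}\to\mathbb{R}$ be scattered sequences, and suppose that $b(n)\to+\infty$ as $n\to\infty$. Then for Lebesgue-almost every $x\in\mathbb{R}$ the sequence $\big(g(x)^{b(n)},\,a(n)f(x)\big)_{n\in\mathbb{N}}$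 is uniformly distributed in $\mathbb{T}^2$. -/

import Mathlib

open Filter Topology MeasureTheory

noncomputable section

/-- A sequence `x 1, x 2, …` in `ℝ^k` (the value at the index `0` is not used) is uniformly
distributed modulo `1`, that is, uniformly distributed in `𝕋^k`, if for all intervals
`I_1, …, I_k ⊆ [0,1]` (open, closed, half-open or degenerate) the proportion of the `n ≤ N` for
which the vector of fractional parts of `x n` lies in `I_1 × ⋯ × I_k` tends to the Lebesgue measure
of that box. -/
def UniformlyDistributedModOne {k : ℕ} (x : ℕ → Fin k → ℝ) : Prop :=
  ∀ I : Fin k → Set ℝ, (∀ i, (I i).OrdConnected ∧ I i ⊆ Set.Icc 0 1) →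
    Tendsto
      (fun N : ℕ =>
        (1 / (N : ℝ)) *
          (({n : ℕ | n ∈ Set.Icc 1 N ∧ (fun i => Int.fract (x n i)) ∈ Set.univ.pi I}).ncard : ℝ))
      atTop (𝓝 ((volume : Measure (Fin k → ℝ)).real (Set.univ.pi I)))

/-- `min (t ^ (-δ), 1)` for `t ≥ 0` and `δ > 0`, with the usual reading `0 ^ (-δ) = ∞`, so that the
value at `t = 0` is `1` (the real power of Lean would give `0` there). -/
def truncatedNegPow (δ t : ℝ) : ℝ :=
  if t = 0 then 1 else min (t ^ (-δ)) 1

/-- `a` is `δ`-scattered: for some `ε > 0` and all large `N`, the sum over `1 ≤ m < n ≤ N` of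
`min (|a n - a m| ^ (-δ), 1)`, divided by `N ^ 2`, is at most `1 / (log N) ^ (1 + ε)`. -/
def DeltaScattered (δ : ℝ) (a : ℕ → ℝ) : Prop :=
  ∃ ε : ℝ, 0 < ε ∧ ∀ᶠ N : ℕ in atTop,
    (1 / (N : ℝ) ^ 2) *
        ∑ n ∈ Finset.Icc 1 N, ∑ m ∈ Finset.Ico 1 n, truncatedNegPow δ |a n - a m|
      ≤ 1 / (Real.log N) ^ (1 + ε)

/-- A sequence is scattered if it is `δ`-scattered for every `δ ∈ (0,1]`. -/
def Scattered (a : ℕ → ℝ) : Prop :=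
  ∀ δ ∈ Set.Ioc (0 : ℝ) 1, DeltaScattered δ a

end

/-! Put `G = log g > 0`. By Weyl's criterion it suffices that, for each nonzero pair of frequencies,
the averages of `exp (i (κ e^(b(n) G(x)) + l a(n) f(x)))` tend to `0` for almost every `x`. A
Davenport–Erdős–LeVeque argument reduces this to bounds on the integrals of products of one such
function with the conjugate of another, over intervals where `f'` and `g'` do not vanish.

If `κ = 0`, such an integral is `O(|a(n) - a(m)|^(-1/2))`. If `κ ≠ 0`, it is `O(|b(n) -
b(m)|^(-1/2))` for large indices, uniformly in the coefficient `A = l (a(n) - a(m))` of `f`. The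
uniformity is the crux (`exists_norm_integral_exp_sub_exp_le`): dividing the derivative of the phase
by `f'` turns `A f'` into the constant `A`, so the derivative of the quotient `ψ` does not depend on
`A`, and the exponentials make it at least a multiple of `|b(n) - b(m)|`. A second-derivative test
of van der Corput type, applied to `ψ`, gives the decay (`norm_integral_exp_mul_I_le`).

Scattering with `δ = 1/2` then bounds the second moments by `(log N)^(-1-ε)`, which is summable
along a subsequence whose consecutive ratios tend to `1` (`ae_tendsto_average_zero`). Analyticity
makes the zeros of `f'` and `g'` a null set, so local results suffice. -/

noncomputable section

/-! ### Weyl's criterion on the torus -/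

/-- The uniform probability measure on the points `y 1, …, y (N + 1)`. -/
def empiricalMeasure {E : Type*} [MeasurableSpace E] (y : ℕ → E) (N : ℕ) : Measure E :=
  ((N + 1 : ℕ) : ENNReal)⁻¹ • ∑ n ∈ Finset.Icc 1 (N + 1), Measure.dirac (y n)

instance {E : Type*} [MeasurableSpace E] (y : ℕ → E) (N : ℕ) :
    IsProbabilityMeasure (empiricalMeasure y N) := by
  constructor
  simp only [empiricalMeasure, Measure.smul_apply, Measure.coe_finsetSum, Finset.sum_apply,
    measure_univ, Finset.sum_const, Nat.card_Icc, smul_eq_mul, nsmul_eq_mul, mul_one]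
  exact ENNReal.inv_mul_cancel (by simp) (by simp)

theorem integral_empiricalMeasure {E : Type*} [MeasurableSpace E] [MeasurableSingletonClass E]
    (y : ℕ → E) (N : ℕ) (F : E → ℂ) :
    ∫ z, F z ∂(empiricalMeasure y N) =
      ((N + 1 : ℕ) : ℂ)⁻¹ * ∑ n ∈ Finset.Icc 1 (N + 1), F (y n) := by
  rw [empiricalMeasure, integral_smul_measure, integral_finsetSum_measure]
  · have : (((N : ENNReal) + 1).toReal : ℂ) = N + 1 := by
      exact_mod_cast congrArg ((↑) : ℝ → ℂ) (ENNReal.toReal_natCast (N + 1))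
    simp [integral_dirac, Complex.real_smul, this]
  · intro i _
    exact integrable_dirac (by simp [enorm_lt_top])

theorem empiricalMeasure_real_apply {E : Type*} [MeasurableSpace E] [MeasurableSingletonClass E]
    (y : ℕ → E) (N : ℕ) (S : Set E) :
    (empiricalMeasure y N).real S =
      ((N + 1 : ℕ) : ℝ)⁻¹ * ({n : ℕ | n ∈ Set.Icc 1 (N + 1) ∧ y n ∈ S}.ncard : ℝ) := by
  classical
  have hset : {n : ℕ | n ∈ Set.Icc 1 (N + 1) ∧ y n ∈ S} =
      ((Finset.Icc 1 (N + 1)).filter (fun n => y n ∈ S) : Finset ℕ) := by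
    ext n; simp
  rw [hset, Set.ncard_coe_finset, Measure.real, empiricalMeasure]
  simp only [Measure.smul_apply, Measure.coe_finsetSum, Finset.sum_apply, Measure.dirac_apply,
    smul_eq_mul, ENNReal.toReal_mul, ENNReal.toReal_inv, ENNReal.toReal_natCast]
  congr 1
  simp [Set.indicator_apply]

/-- The Haar probability measure on the torus, as the image of Lebesgue measure on the unit
cube. -/
def torusMeasure (ι : Type*) [Fintype ι] : Measure (UnitAddTorus ι) :=
  (Measure.pi (fun _ : ι => (volume : Measure ℝ).restrict (Set.Ico 0 1))).map
    (fun x i => (x i : UnitAddCircle))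

theorem measurable_toUnitAddTorus (ι : Type*) [Fintype ι] :
    Measurable (fun (x : ι → ℝ) i => (x i : UnitAddCircle)) :=
  measurable_pi_lambda _ fun i => AddCircle.measurable_mk'.comp (measurable_pi_apply i)

instance restrictIco_isProb : IsProbabilityMeasure ((volume : Measure ℝ).restrict (Set.Ico 0 1)) :=
  ⟨by simp⟩

instance (ι : Type*) [Fintype ι] : IsProbabilityMeasure (torusMeasure ι) :=
  Measure.isProbabilityMeasure_map (measurable_toUnitAddTorus ι).aemeasurable

theorem integral_fourier_Ico {n : ℤ} (hn : n ≠ 0) :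
    ∫ t in Set.Ico (0 : ℝ) 1, fourier n (t : UnitAddCircle) = 0 := by
  rw [integral_Ico_eq_integral_Ioo, ← integral_Ioc_eq_integral_Ioo,
    ← intervalIntegral.integral_of_le zero_le_one]
  have hc : ∀ x : ℝ, HasDerivAt (fun y : ℝ => (1 : ℂ) / (2 * Real.pi * Complex.I * n) *
      fourier n (y : UnitAddCircle)) (fourier n (x : UnitAddCircle)) x := by
    intro x
    have := (hasDerivAt_fourier (1 : ℝ) n x).const_mul ((1 : ℂ) / (2 * Real.pi * Complex.I * n))
    refine this.congr_deriv ?_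
    have : (n : ℂ) ≠ 0 := by exact_mod_cast hn
    have h2 : (Real.pi : ℂ) ≠ 0 := by exact_mod_cast Real.pi_ne_zero
    push_cast
    field_simp
  rw [intervalIntegral.integral_eq_sub_of_hasDerivAt (fun x _ => hc x)]
  · have : ((1 : ℝ) : UnitAddCircle) = 0 := AddCircle.coe_period 1
    simp [this]
  · apply Continuous.intervalIntegrable
    exact (fourier n).continuous.comp (AddCircle.continuous_mk' 1)

theorem integral_mFourier_torusMeasure {ι : Type*} [Fintype ι] {n : ι → ℤ} (hn : n ≠ 0) :
    ∫ y, UnitAddTorus.mFourier n y ∂(torusMeasure ι) = 0 := by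
  obtain ⟨i, hi⟩ := Function.ne_iff.1 hn
  rw [torusMeasure, integral_map (measurable_toUnitAddTorus ι).aemeasurable
    (UnitAddTorus.mFourier n).continuous.aestronglyMeasurable]
  simp only [UnitAddTorus.mFourier, ContinuousMap.coe_mk]
  rw [integral_fintype_prod_eq_prod (fun i (t : ℝ) => fourier (n i) (t : UnitAddCircle))]
  exact Finset.prod_eq_zero (Finset.mem_univ i) (integral_fourier_Ico hi)

/-- Integration against a probability measure is 1-Lipschitz for the sup norm, so convergence passes
from the span to its closure by an `ε / 3` argument. -/
theorem tendsto_integral_of_mem_span_closure {E : Type*} [TopologicalSpace E] [CompactSpace E]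
    [MeasurableSpace E] [BorelSpace E] {μ : ℕ → Measure E} {ν : Measure E}
    [∀ N, IsProbabilityMeasure (μ N)] [IsProbabilityMeasure ν] {A : Set C(E, ℂ)}
    (hA : ∀ F ∈ A, Tendsto (fun N => ∫ z, F z ∂(μ N)) atTop (𝓝 (∫ z, F z ∂ν)))
    {F : C(E, ℂ)} (hF : F ∈ (Submodule.span ℂ A).topologicalClosure) :
    Tendsto (fun N => ∫ z, F z ∂(μ N)) atTop (𝓝 (∫ z, F z ∂ν)) := by
  have int : ∀ (ρ : Measure E) [IsProbabilityMeasure ρ] (F : C(E, ℂ)), Integrable F ρ := by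
    intro ρ _ F
    exact (BoundedContinuousFunction.mkOfCompact F).integrable ρ
  have hspan : ∀ F ∈ Submodule.span ℂ A,
      Tendsto (fun N => ∫ z, F z ∂(μ N)) atTop (𝓝 (∫ z, F z ∂ν)) := by
    intro F hF
    induction hF using Submodule.span_induction with
    | mem F hF => exact hA F hF
    | zero => simp
    | add F G _ _ h1 h2 =>
      have e : ∀ (ρ : Measure E) [IsProbabilityMeasure ρ],
          ∫ z, (F + G) z ∂ρ = ∫ z, F z ∂ρ + ∫ z, G z ∂ρ := by
        intro ρ _
        exact integral_add (int ρ F) (int ρ G)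
      simp only [e]
      exact h1.add h2
    | smul c F _ h =>
      simp only [ContinuousMap.smul_apply, integral_smul]
      exact h.const_smul c
  rw [Metric.tendsto_atTop]
  intro ε hε
  obtain ⟨G, hG, hFG⟩ := Metric.mem_closure_iff.1 (show F ∈ closure _ from hF) (ε / 3) (by positivity)
  obtain ⟨N0, hN0⟩ := Metric.tendsto_atTop.1 (hspan G hG) (ε / 3) (by positivity)
  have close : ∀ (ρ : Measure E) [IsProbabilityMeasure ρ],
      dist (∫ z, F z ∂ρ) (∫ z, G z ∂ρ) ≤ dist F G := by
    intro ρ _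
    rw [dist_eq_norm, ← integral_sub (int ρ F) (int ρ G)]
    have := norm_integral_le_of_norm_le_const (μ := ρ) (f := fun z => F z - G z) (C := dist F G)
      (Eventually.of_forall fun z => by
        rw [← dist_eq_norm]; exact ContinuousMap.dist_apply_le_dist z)
    simpa using this
  refine ⟨N0, fun N hN => ?_⟩
  have h1 := close (μ N)
  have h2 := close ν
  have h3 := hN0 N hN
  rw [dist_comm] at h2
  linarith [dist_triangle4 (∫ z, F z ∂(μ N)) (∫ z, G z ∂(μ N)) (∫ z, G z ∂ν) (∫ z, F z ∂ν)]

/-- The representatives in `[0, 1)` of the coordinates of a point of the torus. -/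
def torusFract {ι : Type*} (y : UnitAddTorus ι) : ι → ℝ :=
  fun i => (AddCircle.equivIco (1 : ℝ) 0 (y i) : ℝ)

theorem torusFract_coe {ι : Type*} (x : ι → ℝ) :
    torusFract (fun i => (x i : UnitAddCircle)) = fun i => Int.fract (x i) := by
  funext i
  simp [torusFract]

theorem torusFract_coe_of_mem {ι : Type*} {x : ι → ℝ} (hx : ∀ i, x i ∈ Set.Ico (0 : ℝ) 1) :
    torusFract (fun i => (x i : UnitAddCircle)) = x := by
  rw [torusFract_coe]
  funext i
  exact Int.fract_eq_self.2 (hx i)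

/-- The representative in `[0, 1)` jumps only at the class of `0`, which the open cube avoids. -/
theorem continuousAt_torusFract {ι : Type*} {x : ι → ℝ} (hx : ∀ i, x i ∈ Set.Ioo (0 : ℝ) 1) :
    ContinuousAt torusFract (fun i => (x i : UnitAddCircle)) := by
  refine continuousAt_pi.2 fun i => ?_
  have h0 : (x i : UnitAddCircle) ≠ ((0 : ℝ) : UnitAddCircle) := by
    intro h
    have := (AddCircle.coe_eq_zero_iff_of_mem_Ico (p := (1 : ℝ)) (a := x i)
      ⟨(hx i).1.le, (hx i).2⟩).1 (by simpa using h)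
    exact (hx i).1.ne' this
  have h1 := AddCircle.continuousAt_equivIco (p := (1 : ℝ)) (a := 0) h0
  exact (continuous_subtype_val.continuousAt.comp h1).comp (f := fun y : UnitAddTorus ι => y i)
    (continuous_apply i).continuousAt

theorem measurable_torusFract {ι : Type*} [Fintype ι] :
    Measurable (torusFract : UnitAddTorus ι → ι → ℝ) := by
  refine measurable_pi_lambda _ fun i => ?_
  exact measurable_subtype_coe.comp
    ((AddCircle.measurableEquivIco (1 : ℝ) 0).measurable.comp (measurable_pi_apply i))

theorem ae_mem_Ioo_pi_restrict_Ico (ι : Type*) [Fintype ι] :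
    ∀ᵐ x ∂(Measure.pi (fun _ : ι => (volume : Measure ℝ).restrict (Set.Ico 0 1))),
      ∀ i, x i ∈ Set.Ioo (0 : ℝ) 1 := by
  rw [← Measure.restrict_congr_set (Ioo_ae_eq_Ico (a := (0 : ℝ)) (b := 1)), ← Measure.restrict_pi_pi]
  filter_upwards [ae_restrict_mem (MeasurableSet.univ_pi fun _ => measurableSet_Ioo)] with x hx i
  exact hx i trivial

/-- **Weyl's criterion** in several dimensions. -/
theorem uniformlyDistributedModOne_of_weyl {k : ℕ} {x : ℕ → Fin k → ℝ}
    (h : ∀ n : Fin k → ℤ, n ≠ 0 →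
      Tendsto (fun N : ℕ => (N : ℂ)⁻¹ *
        ∑ j ∈ Finset.Icc 1 N, UnitAddTorus.mFourier n (fun i => (x j i : UnitAddCircle)))
        atTop (𝓝 0)) :
    UniformlyDistributedModOne x := by
  intro I hI
  set y : ℕ → UnitAddTorus (Fin k) := fun j i => (x j i : UnitAddCircle) with hy
  have hconv : ∀ F : C(UnitAddTorus (Fin k), ℂ),
      Tendsto (fun N => ∫ z, F z ∂(empiricalMeasure y N)) atTop
        (𝓝 (∫ z, F z ∂(torusMeasure (Fin k)))) := by
    intro F
    refine tendsto_integral_of_mem_span_closure (A := Set.range UnitAddTorus.mFourier) ?_ ?_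
    · rintro _ ⟨n, rfl⟩
      by_cases hn : n = 0
      · subst hn
        simp [UnitAddTorus.mFourier_zero]
      · rw [integral_mFourier_torusMeasure hn]
        simp only [integral_empiricalMeasure]
        exact (h n hn).comp (tendsto_add_atTop_nat 1)
    · rw [UnitAddTorus.span_mFourier_closure_eq_top]; trivial
  let μs : ℕ → ProbabilityMeasure (UnitAddTorus (Fin k)) :=
    fun N => ⟨empiricalMeasure y N, inferInstance⟩
  let ν : ProbabilityMeasure (UnitAddTorus (Fin k)) := ⟨torusMeasure (Fin k), inferInstance⟩
  have hlim : Tendsto μs atTop (𝓝 ν) :=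
    (ProbabilityMeasure.tendsto_iff_forall_integral_rclike_tendsto ℂ).2
      fun F => hconv F.toContinuousMap
  set B : Set (Fin k → ℝ) := Set.univ.pi I with hB
  have hBord : B.OrdConnected := Set.ordConnected_pi fun i _ => (hI i).1
  have hBmeas : MeasurableSet B := MeasurableSet.univ_pi fun i => (hI i).1.measurableSet
  set S : Set (UnitAddTorus (Fin k)) := torusFract ⁻¹' B with hS
  have hSmeas : MeasurableSet S := measurable_torusFract hBmeas
  have hmeas := measurable_toUnitAddTorus (Fin k)
  have hpi : (Measure.pi (fun _ : Fin k => (volume : Measure ℝ).restrict (Set.Ico 0 1))) =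
      (volume : Measure (Fin k → ℝ)).restrict (Set.univ.pi fun _ => Set.Ico 0 1) := by
    rw [volume_pi, Measure.restrict_pi_pi]
  -- Where `torusFract` is continuous, a frontier point of `S` maps to a frontier point of `B`. The
  -- frontier of an order-connected set is null, and so is the boundary of the cube.
  have hfront : (ν : Measure (UnitAddTorus (Fin k))) (frontier S) = 0 := by
    change torusMeasure (Fin k) (frontier S) = 0
    rw [torusMeasure, Measure.map_apply hmeas isClosed_frontier.measurableSet]
    have hnull : ∀ᵐ z ∂(Measure.pi (fun _ : Fin k => (volume : Measure ℝ).restrict (Set.Ico 0 1))),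
        z ∉ frontier B := by
      rw [hpi]
      exact ae_restrict_of_ae (measure_eq_zero_iff_ae_notMem.1 hBord.null_frontier)
    rw [measure_eq_zero_iff_ae_notMem]
    filter_upwards [hnull, ae_mem_Ioo_pi_restrict_Ico (Fin k)] with z hz hz' hmem
    have hcont := continuousAt_torusFract hz'
    have hval := torusFract_coe_of_mem (fun i => ⟨(hz' i).1.le, (hz' i).2⟩)
    apply hz
    rw [← hval]
    have hmem' : (fun i => (z i : UnitAddCircle)) ∈ closure S ∩ closure Sᶜ := by
      rwa [← frontier_eq_closure_inter_closure]
    rw [frontier_eq_closure_inter_closure]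
    exact ⟨closure_mono (Set.image_preimage_subset _ _) (mem_closure_image hcont hmem'.1),
      closure_mono (Set.image_preimage_subset _ _) (mem_closure_image hcont hmem'.2)⟩
  have hport := ProbabilityMeasure.tendsto_measure_of_null_frontier_of_tendsto' hlim hfront
  have hport' := (ENNReal.tendsto_toReal (measure_ne_top _ _)).comp hport
  have hνS : (torusMeasure (Fin k)).real S = (volume : Measure (Fin k → ℝ)).real B := by
    rw [Measure.real, Measure.real, torusMeasure, Measure.map_apply hmeas hSmeas]
    congr 1
    -- The intervals may contain `1` while representatives lie in `[0, 1)`; the difference is null.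
    have hcube : (volume : Measure (Fin k → ℝ)).restrict (Set.univ.pi fun _ => Set.Ico 0 1) =
        volume.restrict (Set.univ.pi fun _ => Set.Icc 0 1) := by
      rw [volume_pi, Measure.restrict_pi_pi, Measure.restrict_pi_pi,
        Measure.restrict_congr_set (Ico_ae_eq_Icc (a := (0 : ℝ)) (b := 1))]
    have hB' : (volume : Measure (Fin k → ℝ)) B =
        volume.restrict (Set.univ.pi fun _ => Set.Icc 0 1) B := by
      rw [Measure.restrict_apply hBmeas, Set.inter_eq_left.2]
      exact Set.pi_mono fun i _ => (hI i).2
    rw [hB', ← hcube, ← hpi]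
    apply measure_congr
    filter_upwards [ae_mem_Ioo_pi_restrict_Ico (Fin k)] with z hz
    have : torusFract (fun i => (z i : UnitAddCircle)) = z :=
      torusFract_coe_of_mem (fun i => ⟨(hz i).1.le, (hz i).2⟩)
    change (torusFract (fun i => (z i : UnitAddCircle)) ∈ B) = (z ∈ B)
    rw [this]
  rw [← hνS]
  -- `empiricalMeasure y N` averages `N + 1` points, hence the shift.
  refine (tendsto_add_atTop_iff_nat 1).1 ?_
  refine hport'.congr fun N => ?_
  have := empiricalMeasure_real_apply y N S
  rw [one_div]
  refine this.trans ?_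
  simp only [hS, Set.mem_preimage, hy, torusFract_coe]

/-! ### A van der Corput estimate -/

/-- The integral of `σ ψ' / (ψ² + η²)`, a multiple of the variation of `arctan (ψ / η)`. -/
theorem integral_div_sq_add_sq_le {α β η σ : ℝ} (hαβ : α ≤ β) (hη : 0 < η) (hσ : |σ| = 1)
    {ψ ψ' : ℝ → ℝ} (hψ : ∀ x ∈ Set.Icc α β, HasDerivAt ψ (ψ' x) x)
    (hψ' : ContinuousOn ψ' (Set.Icc α β)) :
    ∫ x in α..β, σ * ψ' x / (ψ x ^ 2 + η ^ 2) ≤ 4 / η := by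
  have hD : ∀ x, 0 < ψ x ^ 2 + η ^ 2 := fun x => by positivity
  have hψc : ContinuousOn ψ (Set.Icc α β) := fun x hx => (hψ x hx).continuousAt.continuousWithinAt
  have hder : ∀ x ∈ Set.uIcc α β,
      HasDerivAt (fun x => σ / η * Real.arctan (ψ x / η)) (σ * ψ' x / (ψ x ^ 2 + η ^ 2)) x := by
    intro x hx
    rw [Set.uIcc_of_le hαβ] at hx
    refine (((hψ x hx).div_const η).arctan.const_mul (σ / η)).congr_deriv ?_
    have := hD x
    have h2 : 1 + (ψ x / η) ^ 2 ≠ 0 := by positivity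
    field_simp
    ring
  rw [intervalIntegral.integral_eq_sub_of_hasDerivAt hder]
  · rw [← mul_sub]
    refine (le_abs_self _).trans ?_
    rw [abs_mul, abs_div, hσ, abs_of_pos hη, div_mul_eq_mul_div, one_mul]
    gcongr
    rw [abs_le]
    constructor <;>
    linarith [Real.pi_lt_four, Real.arctan_lt_pi_div_two (ψ α / η),
      Real.arctan_lt_pi_div_two (ψ β / η), Real.neg_pi_div_two_lt_arctan (ψ α / η),
      Real.neg_pi_div_two_lt_arctan (ψ β / η)]
  · apply ContinuousOn.intervalIntegrable
    rw [Set.uIcc_of_le hαβ]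
    exact (continuousOn_const.mul hψ').div ((hψc.pow 2).add continuousOn_const)
      fun x _ => (hD x).ne'

/-- A van der Corput estimate: if `φ' = ψ / r` with `ψ` monotone, then the oscillatory integral of
`exp (i φ)` is controlled, at each scale `η`, by the size of the set where `|ψ| ≲ η`. -/
theorem norm_integral_exp_mul_I_le {α β η σ R R' : ℝ} (hαβ : α ≤ β) (hη : 0 < η) (hσ : |σ| = 1)
    {r r' φ φ' ψ ψ' : ℝ → ℝ} (hr : ∀ x ∈ Set.Icc α β, HasDerivAt r (r' x) x)
    (hr' : ContinuousOn r' (Set.Icc α β)) (hR : ∀ x ∈ Set.Icc α β, |r x| ≤ R)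
    (hR' : ∀ x ∈ Set.Icc α β, |r' x| ≤ R') (hφ : ∀ x ∈ Set.Icc α β, HasDerivAt φ (φ' x) x)
    (hrφ : ∀ x ∈ Set.Icc α β, r x * φ' x = ψ x) (hψ : ∀ x ∈ Set.Icc α β, HasDerivAt ψ (ψ' x) x)
    (hψ' : ContinuousOn ψ' (Set.Icc α β)) (hmono : ∀ x ∈ Set.Icc α β, 0 ≤ σ * ψ' x) :
    ‖∫ x in α..β, Complex.exp (φ x * Complex.I)‖ ≤
      (6 * R + R' * (β - α)) / η + ∫ x in α..β, η ^ 2 / (ψ x ^ 2 + η ^ 2) := by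
  have hD : ∀ x, 0 < ψ x ^ 2 + η ^ 2 := fun x => by positivity
  have hψc : ContinuousOn ψ (Set.Icc α β) := fun x hx => (hψ x hx).continuousAt.continuousWithinAt
  have hφc : ContinuousOn φ (Set.Icc α β) := fun x hx => (hφ x hx).continuousAt.continuousWithinAt
  have hrc : ContinuousOn r (Set.Icc α β) := fun x hx => (hr x hx).continuousAt.continuousWithinAt
  have hDc : ContinuousOn (fun x => ψ x ^ 2 + η ^ 2) (Set.Icc α β) :=
    (hψc.pow 2).add continuousOn_const
  have hD0 : ∀ x ∈ Set.Icc α β, ψ x ^ 2 + η ^ 2 ≠ 0 := fun x _ => (hD x).ne'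
  have hR0 : 0 ≤ R := (abs_nonneg _).trans (hR α ⟨le_rfl, hαβ⟩)
  have hquot : ∀ x, |ψ x / (ψ x ^ 2 + η ^ 2)| ≤ 1 / η := by
    intro x
    rw [abs_div, abs_of_pos (hD x), div_le_div_iff₀ (hD x) hη]
    nlinarith [sq_nonneg (|ψ x| - η), sq_abs (ψ x), abs_nonneg (ψ x)]
  set e : ℝ → ℂ := fun x => Complex.exp (φ x * Complex.I) with he
  have hnorm : ∀ x, ‖e x‖ = 1 := fun x => Complex.norm_exp_ofReal_mul_I _
  have hec : ContinuousOn e (Set.Icc α β) :=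
    Complex.continuous_exp.comp_continuousOn
      ((Complex.continuous_ofReal.comp_continuousOn hφc).mul continuousOn_const)
  -- `W` is a regularised `1 / φ'`: since `r φ' = ψ`, we have `φ' W = ψ² / (ψ² + η²) = 1 - T`.
  -- Integrating `(e W)'` therefore behaves like the usual integration by parts, without blowing up
  -- at stationary points; the price is the integral of `T`.
  set W : ℝ → ℝ := fun x => r x * (ψ x / (ψ x ^ 2 + η ^ 2)) with hW
  set W' : ℝ → ℝ := fun x => r' x * (ψ x / (ψ x ^ 2 + η ^ 2)) +
    r x * (ψ' x * (η ^ 2 - ψ x ^ 2) / (ψ x ^ 2 + η ^ 2) ^ 2) with hW'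
  set T : ℝ → ℝ := fun x => η ^ 2 / (ψ x ^ 2 + η ^ 2) with hT
  have hW'c : ContinuousOn W' (Set.Icc α β) :=
    (hr'.mul (hψc.div hDc hD0)).add (hrc.mul ((hψ'.mul (continuousOn_const.sub (hψc.pow 2))).div
      (hDc.pow 2) fun x _ => (pow_pos (hD x) 2).ne'))
  have hTc : ContinuousOn T (Set.Icc α β) := continuousOn_const.div hDc hD0
  have hWder : ∀ x ∈ Set.Icc α β, HasDerivAt W (W' x) x := by
    intro x hx
    have h1 : HasDerivAt (fun x => ψ x / (ψ x ^ 2 + η ^ 2)) _ x :=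
      (hψ x hx).div (((hψ x hx).pow 2).add_const (η ^ 2)) (hD x).ne'
    refine ((hr x hx).mul h1).congr_deriv ?_
    simp only [hW']
    have := (hD x).ne'
    field_simp
    push_cast
    ring
  have hwder : ∀ x ∈ Set.uIcc α β, HasDerivAt (fun x => e x * (W x : ℂ))
      (Complex.I * e x - (Complex.I * e x * (T x : ℂ) - e x * (W' x : ℂ))) x := by
    intro x hx
    rw [Set.uIcc_of_le hαβ] at hx
    have h1 : HasDerivAt e (e x * (φ' x * Complex.I)) x :=
      ((hφ x hx).ofReal_comp.mul_const Complex.I).cexp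
    refine (h1.mul (hWder x hx).ofReal_comp).congr_deriv ?_
    have h2 : φ' x * W x = 1 - T x := by
      have := (hD x).ne'
      simp only [hW, hT]
      rw [← mul_assoc, mul_comm (φ' x), hrφ x hx]
      field_simp
      ring
    have h3 : (φ' x : ℂ) * (W x : ℂ) = 1 - (T x : ℂ) := by exact_mod_cast h2
    linear_combination e x * Complex.I * h3
  have hi1 : IntervalIntegrable (fun x => Complex.I * e x) volume α β := by
    apply ContinuousOn.intervalIntegrable
    rw [Set.uIcc_of_le hαβ]
    exact continuousOn_const.mul hec
  have hi2c : ContinuousOn (fun x => Complex.I * e x * (T x : ℂ) - e x * (W' x : ℂ))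
      (Set.Icc α β) :=
    ((continuousOn_const.mul hec).mul (Complex.continuous_ofReal.comp_continuousOn hTc)).sub
      (hec.mul (Complex.continuous_ofReal.comp_continuousOn hW'c))
  have hi2 : IntervalIntegrable (fun x => Complex.I * e x * (T x : ℂ) - e x * (W' x : ℂ))
      volume α β := by
    apply ContinuousOn.intervalIntegrable
    rwa [Set.uIcc_of_le hαβ]
  have hint := intervalIntegral.integral_eq_sub_of_hasDerivAt hwder (hi1.sub hi2)
  rw [intervalIntegral.integral_sub hi1 hi2, intervalIntegral.integral_const_mul] at hint
  have hmain : Complex.I * ∫ x in α..β, e x = (e β * (W β : ℂ) - e α * (W α : ℂ)) +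
      ∫ x in α..β, (Complex.I * e x * (T x : ℂ) - e x * (W' x : ℂ)) := by
    linear_combination hint
  have hbd : ∀ x ∈ Set.Icc α β, ‖e x * (W x : ℂ)‖ ≤ R / η := by
    intro x hx
    rw [norm_mul, hnorm, one_mul, Complex.norm_real, Real.norm_eq_abs, hW, abs_mul, div_eq_mul_one_div R]
    exact mul_le_mul (hR x hx) (hquot x) (abs_nonneg _) hR0
  have hTi : IntervalIntegrable T volume α β := by
    apply ContinuousOn.intervalIntegrable; rwa [Set.uIcc_of_le hαβ]
  have hQi : IntervalIntegrable (fun x => σ * ψ' x / (ψ x ^ 2 + η ^ 2)) volume α β := by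
    apply ContinuousOn.intervalIntegrable
    rw [Set.uIcc_of_le hαβ]
    exact (continuousOn_const.mul hψ').div hDc hD0
  -- The derivative of `ψ / (ψ² + η²)` is at most `|ψ'| / (ψ² + η²)`, whose integral is at most `4 /
  -- η` because `ψ'` has constant sign. With the two boundary terms `R / η` this accounts for the
  -- constant `6 R`.
  have hpt : ∀ x ∈ Set.Icc α β, ‖Complex.I * e x * (T x : ℂ) - e x * (W' x : ℂ)‖ ≤
      T x + (R' / η + R * (σ * ψ' x / (ψ x ^ 2 + η ^ 2))) := by
    intro x hx
    refine (norm_sub_le _ _).trans ?_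
    rw [norm_mul, norm_mul, norm_mul, hnorm, Complex.norm_I, one_mul, one_mul, one_mul,
      Complex.norm_real, Complex.norm_real, Real.norm_eq_abs, Real.norm_eq_abs,
      abs_of_nonneg (show 0 ≤ T x from div_nonneg (sq_nonneg _) (hD x).le)]
    gcongr
    refine (abs_add_le _ _).trans (add_le_add ?_ ?_)
    · rw [abs_mul, div_eq_mul_one_div R']
      exact mul_le_mul (hR' x hx) (hquot x) (abs_nonneg _) ((abs_nonneg _).trans (hR' x hx))
    · rw [abs_mul]
      refine mul_le_mul (hR x hx) ?_ (abs_nonneg _) hR0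
      have h1 : |ψ' x| = σ * ψ' x := by
        rw [← abs_of_nonneg (hmono x hx), abs_mul, hσ, one_mul]
      rw [abs_div, abs_mul, h1, abs_of_pos (pow_pos (hD x) 2), div_le_div_iff₀ (pow_pos (hD x) 2) (hD x)]
      have h2 : |η ^ 2 - ψ x ^ 2| ≤ ψ x ^ 2 + η ^ 2 := by
        rw [abs_le]; constructor <;> nlinarith [sq_nonneg η, sq_nonneg (ψ x)]
      have h3 := mul_le_mul_of_nonneg_left h2 (mul_nonneg (hmono x hx) (hD x).le)
      nlinarith [h3]
  have hint2 : ‖∫ x in α..β, (Complex.I * e x * (T x : ℂ) - e x * (W' x : ℂ))‖ ≤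
      (∫ x in α..β, T x) + (R' / η * (β - α) + R * (4 / η)) := by
    have hci : IntervalIntegrable (fun _ => R' / η) volume α β := intervalIntegrable_const
    have h1 := intervalIntegral.norm_integral_le_of_norm_le hαβ (μ := volume)
      (f := fun x => Complex.I * e x * (T x : ℂ) - e x * (W' x : ℂ))
      (g := fun x => T x + (R' / η + R * (σ * ψ' x / (ψ x ^ 2 + η ^ 2))))
      (Eventually.of_forall fun x hx => hpt x ⟨hx.1.le, hx.2⟩)
      (hTi.add (hci.add (hQi.const_mul R)))
    refine h1.trans ?_
    rw [intervalIntegral.integral_add hTi (hci.add (hQi.const_mul R)),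
      intervalIntegral.integral_add hci (hQi.const_mul R), intervalIntegral.integral_const,
      intervalIntegral.integral_const_mul, smul_eq_mul, mul_comm (β - α)]
    gcongr
    exact integral_div_sq_add_sq_le hαβ hη hσ hψ hψ'
  have hfin : ‖∫ x in α..β, e x‖ = ‖Complex.I * ∫ x in α..β, e x‖ := by simp
  rw [hfin, hmain]
  have h4 := hbd β ⟨hαβ, le_rfl⟩
  have h5 := hbd α ⟨le_rfl, hαβ⟩
  have h6 := norm_add_le (e β * (W β : ℂ) - e α * (W α : ℂ))
    (∫ x in α..β, (Complex.I * e x * (T x : ℂ) - e x * (W' x : ℂ)))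
  have h7 := norm_sub_le (e β * (W β : ℂ)) (e α * (W α : ℂ))
  have h8 : (6 * R + R' * (β - α)) / η = R / η + R / η + (R' / η * (β - α) + R * (4 / η)) := by
    field_simp; ring
  rw [h8]
  linarith

/-- If moreover `|ψ'| ≥ η²`, the oscillatory integral is `O(1 / η)`. -/
theorem norm_integral_exp_mul_I_le_of_sq_le {α β η σ R R' : ℝ} (hαβ : α ≤ β) (hη : 0 < η)
    (hσ : |σ| = 1) {r r' φ φ' ψ ψ' : ℝ → ℝ} (hr : ∀ x ∈ Set.Icc α β, HasDerivAt r (r' x) x)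
    (hr' : ContinuousOn r' (Set.Icc α β)) (hR : ∀ x ∈ Set.Icc α β, |r x| ≤ R)
    (hR' : ∀ x ∈ Set.Icc α β, |r' x| ≤ R') (hφ : ∀ x ∈ Set.Icc α β, HasDerivAt φ (φ' x) x)
    (hrφ : ∀ x ∈ Set.Icc α β, r x * φ' x = ψ x) (hψ : ∀ x ∈ Set.Icc α β, HasDerivAt ψ (ψ' x) x)
    (hψ' : ContinuousOn ψ' (Set.Icc α β)) (hlarge : ∀ x ∈ Set.Icc α β, η ^ 2 ≤ σ * ψ' x) :
    ‖∫ x in α..β, Complex.exp (φ x * Complex.I)‖ ≤ (6 * R + R' * (β - α) + 4) / η := by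
  have hD : ∀ x, 0 < ψ x ^ 2 + η ^ 2 := fun x => by positivity
  have hψc : ContinuousOn ψ (Set.Icc α β) := fun x hx => (hψ x hx).continuousAt.continuousWithinAt
  have hDc : ContinuousOn (fun x => ψ x ^ 2 + η ^ 2) (Set.Icc α β) :=
    (hψc.pow 2).add continuousOn_const
  have hD0 : ∀ x ∈ Set.Icc α β, ψ x ^ 2 + η ^ 2 ≠ 0 := fun x _ => (hD x).ne'
  refine (norm_integral_exp_mul_I_le hαβ hη hσ hr hr' hR hR' hφ hrφ hψ hψ'
    fun x hx => (sq_nonneg η).trans (hlarge x hx)).trans ?_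
  rw [add_div _ (4 : ℝ)]
  -- As `η² ≤ σ ψ'`, the integrand `T` is dominated by the arctangent derivative, which contributes
  -- the additional `4 / η`.
  refine add_le_add le_rfl (le_trans ?_ (integral_div_sq_add_sq_le hαβ hη hσ hψ hψ'))
  apply intervalIntegral.integral_mono_on hαβ
  · apply ContinuousOn.intervalIntegrable
    rw [Set.uIcc_of_le hαβ]
    exact continuousOn_const.div hDc hD0
  · apply ContinuousOn.intervalIntegrable
    rw [Set.uIcc_of_le hαβ]
    exact (continuousOn_const.mul hψ').div hDc hD0
  · intro x hx
    have := hlarge x hx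
    have := hD x
    gcongr

/-! ### Decay of the correlation integrals -/

theorem exists_sign_of_ne_zero {α β : ℝ} {q : ℝ → ℝ} (hq : ContinuousOn q (Set.Icc α β))
    (hne : ∀ x ∈ Set.Icc α β, q x ≠ 0) :
    ∃ σ : ℝ, |σ| = 1 ∧ ∀ x ∈ Set.Icc α β, σ * q x = |q x| := by
  by_cases hpos : ∀ x ∈ Set.Icc α β, 0 < q x
  · exact ⟨1, by simp, fun x hx => by rw [one_mul, abs_of_pos (hpos x hx)]⟩
  · push Not at hpos
    obtain ⟨y, hy, hqy⟩ := hpos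
    refine ⟨-1, by simp, fun x hx => ?_⟩
    rw [neg_one_mul, abs_of_nonpos]
    by_contra! hqx
    obtain ⟨z, hz, hz0⟩ :=
      isPreconnected_Icc.intermediate_value hy hx hq (show (0 : ℝ) ∈ Set.Icc _ _ from ⟨hqy, hqx.le⟩)
    exact hne z hz hz0

theorem exists_bound_Icc {α β : ℝ} {q : ℝ → ℝ} (hq : ContinuousOn q (Set.Icc α β)) :
    ∃ P : ℝ, 0 ≤ P ∧ ∀ x ∈ Set.Icc α β, |q x| ≤ P := by
  obtain ⟨P, hP⟩ := isCompact_Icc.exists_bound_of_continuousOn hq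
  exact ⟨max P 0, le_max_right _ _, fun x hx => (hP x hx).trans (le_max_left _ _)⟩

theorem hasDerivAt_deriv_of_contDiff {f : ℝ → ℝ} (hf : ContDiff ℝ 2 f) (x : ℝ) :
    HasDerivAt f (deriv f x) x ∧ HasDerivAt (deriv f) (deriv (deriv f) x) x ∧
      Continuous (deriv f) ∧ Continuous (deriv (deriv f)) := by
  have h1 : ContDiff ℝ 1 (deriv f) := by
    have : ContDiff ℝ (1 + 1) f := by norm_num; exact hf
    exact (contDiff_succ_iff_deriv.1 this).2.2
  refine ⟨(hf.differentiable (by norm_num) x).hasDerivAt,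
    (h1.differentiable (by norm_num) x).hasDerivAt, h1.continuous, ?_⟩
  have : ContDiff ℝ (0 + 1) (deriv f) := by norm_num; exact h1
  exact (contDiff_succ_iff_deriv.1 this).2.2.continuous

/-- Oscillatory integrals with phase `κ (e ^ (b G) - e ^ (b' G)) + A f` decay in `b - b'`,
uniformly in `A`. -/
theorem exists_norm_integral_exp_sub_exp_le {α β : ℝ} (hαβ : α ≤ β) {f G : ℝ → ℝ}
    (hf : ContDiff ℝ 2 f) (hG : ContDiff ℝ 2 G) (hf' : ∀ x ∈ Set.Icc α β, deriv f x ≠ 0)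
    (hG' : ∀ x ∈ Set.Icc α β, deriv G x ≠ 0) (hG0 : ∀ x ∈ Set.Icc α β, 0 ≤ G x)
    {κ : ℝ} (hκ : κ ≠ 0) :
    ∃ C B : ℝ, ∀ b b' A : ℝ, B ≤ b' → b' < b →
      ‖∫ x in α..β, Complex.exp
        ((κ * (Real.exp (b * G x) - Real.exp (b' * G x)) + A * f x : ℝ) * Complex.I)‖ ≤
        C / √(b - b') := by
  set f1 := deriv f with hf1
  set f2 := deriv f1 with hf2
  set G1 := deriv G with hG1
  set G2 := deriv G1 with hG2
  have df := fun x => (hasDerivAt_deriv_of_contDiff hf x).1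
  have df1 := fun x => (hasDerivAt_deriv_of_contDiff hf x).2.1
  have cf1 := (hasDerivAt_deriv_of_contDiff hf 0).2.2.1
  have cf2 := (hasDerivAt_deriv_of_contDiff hf 0).2.2.2
  have dG := fun x => (hasDerivAt_deriv_of_contDiff hG x).1
  have dG1 := fun x => (hasDerivAt_deriv_of_contDiff hG x).2.1
  have cG1 := (hasDerivAt_deriv_of_contDiff hG 0).2.2.1
  have cG2 := (hasDerivAt_deriv_of_contDiff hG 0).2.2.2
  rw [← hf1] at df df1 cf1 cf2
  rw [← hf2] at df1 cf2
  rw [← hG1] at dG dG1 cG1 cG2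
  rw [← hG2] at dG1 cG2
  set r : ℝ → ℝ := fun x => (f1 x)⁻¹ with hr
  set r' : ℝ → ℝ := fun x => -f2 x / f1 x ^ 2 with hr'
  -- With `E1`, `E2` below, `ψ = κ G' E1 / f' + A` and `ψ' = κ (p' E1 + q E2)`. Here `p'` is the
  -- derivative of `G' / f'`, and `q = G'² / f'` does not vanish.
  set p' : ℝ → ℝ := fun x => G2 x * r x + G1 x * r' x with hp'
  set q : ℝ → ℝ := fun x => G1 x * r x * G1 x with hq
  have cr : ContinuousOn r (Set.Icc α β) := cf1.continuousOn.inv₀ hf'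
  have cr' : ContinuousOn r' (Set.Icc α β) :=
    cf2.neg.continuousOn.div (cf1.pow 2).continuousOn fun x hx => pow_ne_zero 2 (hf' x hx)
  have cp' : ContinuousOn p' (Set.Icc α β) :=
    (cG2.continuousOn.mul cr).add (cG1.continuousOn.mul cr')
  have cq : ContinuousOn q (Set.Icc α β) := (cG1.continuousOn.mul cr).mul cG1.continuousOn
  have hq0 : ∀ x ∈ Set.Icc α β, q x ≠ 0 := fun x hx =>
    mul_ne_zero (mul_ne_zero (hG' x hx) (inv_ne_zero (hf' x hx))) (hG' x hx)
  obtain ⟨R, hR0, hR⟩ := exists_bound_Icc cr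
  obtain ⟨R', hR'0, hR'⟩ := exists_bound_Icc cr'
  obtain ⟨P, hP0, hP⟩ := exists_bound_Icc cp'
  obtain ⟨M, hM0, hM⟩ := exists_bound_Icc (cq.inv₀ hq0)
  obtain ⟨σ, hσ, hσq⟩ := exists_sign_of_ne_zero cq hq0
  set c : ℝ := 1 / (M + 1) with hc
  have hc0 : 0 < c := by positivity
  have hcq : ∀ x ∈ Set.Icc α β, c ≤ |q x| := by
    intro x hx
    have h1 := hM x hx
    have h2 : 0 < |q x| := abs_pos.2 (hq0 x hx)
    rw [Pi.inv_apply, abs_inv] at h1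
    rw [hc, one_div]
    exact inv_le_of_inv_le₀ h2 (by linarith)
  -- For `b ≥ 2 P / c` the term in `p'` costs at most half of the main term `|q| E2 ≥ c b E1`. The
  -- half that remains is at least `(c / 2) (b - b')`, which dictates `η² = |κ| (c / 2) (b - b')`.
  refine ⟨(6 * R + R' * (β - α) + 4) / √(|κ| * (c / 2)), max 1 (2 * P / c), ?_⟩
  intro b b' A hb' hbb'
  have hb'1 : 1 ≤ b' := (le_max_left _ _).trans hb'
  have hbP : P ≤ c / 2 * b := by
    have : 2 * P / c ≤ b := ((le_max_right _ _).trans hb').trans hbb'.le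
    rw [div_le_iff₀ hc0] at this
    linarith
  set E1 : ℝ → ℝ := fun x => b * Real.exp (b * G x) - b' * Real.exp (b' * G x) with hE1
  set E2 : ℝ → ℝ := fun x => b ^ 2 * Real.exp (b * G x) - b' ^ 2 * Real.exp (b' * G x) with hE2
  have cG : Continuous G := hG.continuous
  have cE1 : Continuous E1 := by fun_prop
  have cE2 : Continuous E2 := by fun_prop
  have dexp : ∀ (s x : ℝ), HasDerivAt (fun x => Real.exp (s * G x))
      (Real.exp (s * G x) * (s * G1 x)) x := fun s x => ((dG x).const_mul s).exp
  -- Here `G ≥ 0` enters: both exponentials are at least `1`, and they are ordered as `b` and `b'`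
  -- are.
  have hE1b : ∀ x ∈ Set.Icc α β, b - b' ≤ E1 x := by
    intro x hx
    have h0 := hG0 x hx
    have h1 : Real.exp (b' * G x) ≤ Real.exp (b * G x) := by gcongr
    have h2 : 1 ≤ Real.exp (b' * G x) := Real.one_le_exp (by positivity)
    have h3 := mul_le_mul_of_nonneg_left h1 (show 0 ≤ b by linarith)
    have h4 := mul_le_mul_of_nonneg_left h2 (sub_nonneg.2 hbb'.le)
    simp only [hE1]
    linarith
  have hE2b : ∀ x, b * E1 x ≤ E2 x := by
    intro x
    have h1 : 0 ≤ b' * (b - b') * Real.exp (b' * G x) :=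
      mul_nonneg (mul_nonneg (by linarith) (by linarith)) (Real.exp_pos _).le
    simp only [hE1, hE2]
    linarith
  have hτ : |(κ / |κ|)| = 1 := by rw [abs_div, abs_abs, div_self (abs_ne_zero.2 hκ)]
  have hτκ : κ / |κ| * κ = |κ| := by
    rw [div_mul_eq_mul_div, ← abs_mul_abs_self, mul_div_assoc, div_self (abs_ne_zero.2 hκ), mul_one]
  have hpos : 0 < |κ| * (c / 2) := by positivity
  have hmain := norm_integral_exp_mul_I_le_of_sq_le (η := √(|κ| * (c / 2) * (b - b')))
    (σ := σ * (κ / |κ|)) (r := r) (r' := r') (R := R) (R' := R')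
    (φ := fun x => κ * (Real.exp (b * G x) - Real.exp (b' * G x)) + A * f x)
    (φ' := fun x => κ * G1 x * E1 x + A * f1 x) (ψ := fun x => κ * (G1 x * r x * E1 x) + A)
    (ψ' := fun x => κ * (p' x * E1 x + q x * E2 x)) hαβ
    (Real.sqrt_pos.2 (mul_pos hpos (sub_pos.2 hbb'))) (by rw [abs_mul, hσ, hτ, one_mul])
    ?_ cr' hR hR' ?_ ?_ ?_ ?_ ?_
  · refine hmain.trans (le_of_eq ?_)
    rw [Real.sqrt_mul hpos.le, ← div_div]
  · intro x hx
    exact (df1 x).inv (hf' x hx)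
  · intro x _
    refine ((((dexp b x).sub (dexp b' x)).const_mul κ).add ((df x).const_mul A)).congr_deriv ?_
    simp only [hE1]
    ring
  · intro x hx
    have : r x * f1 x = 1 := inv_mul_cancel₀ (hf' x hx)
    linear_combination A * this
  · intro x hx
    have h1 : HasDerivAt r (r' x) x := (df1 x).inv (hf' x hx)
    have h2 : HasDerivAt E1 (G1 x * E2 x) x := by
      refine (((dexp b x).const_mul b).sub ((dexp b' x).const_mul b')).congr_deriv ?_
      simp only [hE2]
      ring
    refine (((((dG1 x).mul h1).mul h2).const_mul κ).add_const A).congr_deriv ?_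
    simp only [hp', hq, Pi.mul_apply]
    ring
  · exact continuousOn_const.mul ((cp'.mul cE1.continuousOn).add (cq.mul cE2.continuousOn))
  · intro x hx
    rw [Real.sq_sqrt (mul_pos hpos (sub_pos.2 hbb')).le]
    have h1 := hE1b x hx
    have hE1pos : 0 ≤ E1 x := (sub_pos.2 hbb').le.trans h1
    have h2 : σ * (κ / |κ|) * (κ * (p' x * E1 x + q x * E2 x)) =
        |κ| * (σ * p' x * E1 x + |q x| * E2 x) := by
      rw [← hσq x hx]
      linear_combination (σ * (p' x * E1 x + q x * E2 x)) * hτκ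
    rw [h2, mul_assoc]
    refine mul_le_mul_of_nonneg_left ?_ (abs_nonneg _)
    have h3 : -(c / 2 * b) ≤ σ * p' x := by
      have : |σ * p' x| ≤ P := by rw [abs_mul, hσ, one_mul]; exact hP x hx
      linarith [(abs_le.1 this).1]
    have h4 := mul_le_mul_of_nonneg_right h3 hE1pos
    have h5 : c * (b * E1 x) ≤ |q x| * E2 x :=
      mul_le_mul (hcq x hx) (hE2b x) (mul_nonneg (by linarith) hE1pos) (abs_nonneg _)
    have h6 : 1 * E1 x ≤ b * E1 x := mul_le_mul_of_nonneg_right (by linarith) hE1pos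
    nlinarith

/-- Oscillatory integrals with phase `l s f` decay in `s`. -/
theorem exists_norm_integral_exp_mul_le {α β : ℝ} (hαβ : α ≤ β) {f : ℝ → ℝ}
    (hf : ContDiff ℝ 2 f) (hf' : ∀ x ∈ Set.Icc α β, deriv f x ≠ 0) {l : ℝ} (hl : l ≠ 0) :
    ∃ C : ℝ, ∀ s : ℝ, 1 ≤ |s| →
      ‖∫ x in α..β, Complex.exp ((l * s * f x : ℝ) * Complex.I)‖ ≤ C / √|s| := by
  have df := fun x => (hasDerivAt_deriv_of_contDiff hf x).1
  have df1 := fun x => (hasDerivAt_deriv_of_contDiff hf x).2.1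
  have cf1 := (hasDerivAt_deriv_of_contDiff hf 0).2.2.1
  have cf2 := (hasDerivAt_deriv_of_contDiff hf 0).2.2.2
  have cr : ContinuousOn (fun x => (deriv f x)⁻¹) (Set.Icc α β) := cf1.continuousOn.inv₀ hf'
  have cr' : ContinuousOn (fun x => -deriv (deriv f) x / deriv f x ^ 2) (Set.Icc α β) :=
    cf2.neg.continuousOn.div (cf1.pow 2).continuousOn fun x hx => pow_ne_zero 2 (hf' x hx)
  obtain ⟨R, hR0, hR⟩ := exists_bound_Icc cr
  obtain ⟨R', hR'0, hR'⟩ := exists_bound_Icc cr'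
  refine ⟨6 * R + R' * (β - α) + (β - α) / l ^ 2, fun s hs => ?_⟩
  have hs0 : 0 < |s| := by linarith
  -- With `r = 1 / f'` the function `ψ = l s` is constant, so no lower bound on `ψ'` is available;
  -- instead the integral of `T` is at most `(β - α) |s| / (l s)²`, and `|s| ≥ 1` turns this into
  -- `O(|s|^(-1/2))`.
  have h := norm_integral_exp_mul_I_le (η := √|s|) (σ := 1) (φ := fun x => l * s * f x)
    (φ' := fun x => l * s * deriv f x) (ψ := fun _ => l * s) (ψ' := fun _ => 0) hαβ
    (Real.sqrt_pos.2 hs0) (by simp) (fun x hx => (df1 x).inv (hf' x hx)) cr' hR hR'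
    (fun x _ => (df x).const_mul _) ?_ (fun x _ => hasDerivAt_const _ _) continuousOn_const
    (fun _ _ => by simp)
  · refine h.trans ?_
    rw [add_div _ ((β - α) / l ^ 2)]
    refine add_le_add le_rfl ?_
    rw [intervalIntegral.integral_const, smul_eq_mul, Real.sq_sqrt hs0.le, div_div, mul_div_assoc']
    have hl2 : 0 < l ^ 2 := by positivity
    rw [div_le_div_iff₀ (by positivity) (by positivity), mul_assoc]
    refine mul_le_mul_of_nonneg_left ?_ (sub_nonneg.2 hαβ)
    have h1 : √|s| ≤ |s| := by
      rw [Real.sqrt_le_left hs0.le]; nlinarith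
    have h2 : (l * s) ^ 2 = l ^ 2 * (|s| * |s|) := by rw [abs_mul_abs_self]; ring
    rw [h2]
    have h3 : |s| * √|s| ≤ |s| * |s| := mul_le_mul_of_nonneg_left h1 hs0.le
    have h4 := mul_le_mul_of_nonneg_left h3 hl2.le
    nlinarith
  · intro x hx
    have : (deriv f x)⁻¹ * deriv f x = 1 := inv_mul_cancel₀ (hf' x hx)
    linear_combination (l * s) * this

/-! ### From second moments to almost everywhere convergence -/

/-- Take `c j = ⌈exp (j ^ θ)⌉` with `1 / (1 + ε) < θ < 1`. The condition `θ < 1` makes consecutive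
ratios tend to `1`, and `θ (1 + ε) > 1` makes `(log (c j))^(-1-ε)` summable. -/
theorem exists_subexponential_subseq {ε : ℝ} (hε : 0 < ε) :
    ∃ (c : ℕ → ℕ) (s : ℝ), 1 < s ∧ Tendsto c atTop atTop ∧
      (∀ a : ℝ, 1 < a → ∀ᶠ j in atTop, (c (j + 1) : ℝ) ≤ a * c j) ∧
      ∀ j : ℕ, (j : ℝ) ^ s ≤ (Real.log (c j)) ^ (1 + ε) := by
  set θ : ℝ := 1 / (1 + ε / 2) with hθ
  have hθ0 : 0 < θ := by positivity
  have hθ1 : θ < 1 := by rw [hθ, div_lt_one (by positivity)]; linarith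
  have hexp : Tendsto (fun j : ℕ => Real.exp ((j : ℝ) ^ θ)) atTop atTop :=
    Real.tendsto_exp_atTop.comp ((tendsto_rpow_atTop hθ0).comp tendsto_natCast_atTop_atTop)
  set c : ℕ → ℕ := fun j => ⌈Real.exp ((j : ℝ) ^ θ)⌉₊ with hc
  have hcpos : ∀ j : ℕ, Real.exp ((j : ℝ) ^ θ) ≤ c j := fun j => Nat.le_ceil _
  have hctop : Tendsto c atTop atTop := tendsto_nat_ceil_atTop.comp hexp
  have hlim : Tendsto (fun j : ℕ => (c j : ℝ) / Real.exp ((j : ℝ) ^ θ)) atTop (𝓝 1) :=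
    (tendsto_nat_ceil_div_atTop (R := ℝ)).comp hexp
  have hdiff : Tendsto (fun j : ℕ => ((j + 1 : ℕ) : ℝ) ^ θ - (j : ℝ) ^ θ) atTop (𝓝 0) := by
    have hup : Tendsto (fun j : ℕ => θ * (j : ℝ) ^ (θ - 1)) atTop (𝓝 0) := by
      have := (tendsto_rpow_neg_atTop (show 0 < 1 - θ by linarith)).comp
        (tendsto_natCast_atTop_atTop (R := ℝ))
      simpa [Function.comp_def] using this.const_mul θ
    refine tendsto_of_tendsto_of_tendsto_of_le_of_le' tendsto_const_nhds hup
      (Eventually.of_forall fun j => ?_) ?_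
    · exact sub_nonneg.2 (Real.rpow_le_rpow (by positivity) (by push_cast; linarith) hθ0.le)
    · filter_upwards [eventually_gt_atTop 0] with j hj
      have hj' : (0 : ℝ) < j := by exact_mod_cast hj
      -- Bernoulli's inequality for exponents in `[0, 1]` gives `(j + 1)^θ - j^θ ≤ θ j^(θ - 1)`.
      have h1 := rpow_one_add_le_one_add_mul_self (s := 1 / (j : ℝ)) (p := θ)
        (by have : (0 : ℝ) ≤ 1 / j := by positivity
            linarith) hθ0.le hθ1.le
      have h2 : ((j + 1 : ℕ) : ℝ) = j * (1 + 1 / j) := by push_cast; field_simp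
      rw [h2, Real.mul_rpow hj'.le (by positivity), Real.rpow_sub_one hj'.ne']
      have h3 := mul_le_mul_of_nonneg_left h1 (Real.rpow_nonneg hj'.le θ)
      have h4 : (j : ℝ) ^ θ * (1 + θ * (1 / j)) = j ^ θ + θ * (j ^ θ / j) := by ring
      linarith
  refine ⟨c, θ * (1 + ε), ?_, hctop, ?_, ?_⟩
  · rw [hθ, div_mul_eq_mul_div, one_mul, one_lt_div (by positivity)]
    linarith
  · intro a ha
    have h1 : Tendsto (fun j : ℕ => (c (j + 1) : ℝ) / c j) atTop (𝓝 1) := by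
      have h2 := ((hlim.comp (tendsto_add_atTop_nat 1)).div hlim one_ne_zero).mul
        ((Real.continuous_exp.tendsto _).comp hdiff)
      simp only [div_one, Real.exp_zero, mul_one] at h2
      refine h2.congr fun j => ?_
      have h3 : (c j : ℝ) ≠ 0 := ((Real.exp_pos _).trans_le (hcpos j)).ne'
      simp only [Function.comp_apply, Real.exp_sub, Pi.div_apply]
      have := (Real.exp_pos ((j : ℝ) ^ θ)).ne'
      have := (Real.exp_pos (((j + 1 : ℕ) : ℝ) ^ θ)).ne'
      field_simp
    filter_upwards [h1.eventually_lt_const ha] with j hj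
    rw [div_lt_iff₀ ((Real.exp_pos _).trans_le (hcpos j))] at hj
    exact hj.le
  · intro j
    have h1 : (j : ℝ) ^ θ ≤ Real.log (c j) := by
      rw [Real.le_log_iff_exp_le ((Real.exp_pos _).trans_le (hcpos j))]
      exact hcpos j
    rw [Real.rpow_mul (by positivity)]
    exact Real.rpow_le_rpow (by positivity) h1 (by linarith)

theorem tendsto_average_of_subseq_real {v : ℕ → ℝ} (hv : ∀ n, |v n| ≤ 1) {c : ℕ → ℕ}
    (hc : Tendsto c atTop atTop)
    (hratio : ∀ a : ℝ, 1 < a → ∀ᶠ j in atTop, (c (j + 1) : ℝ) ≤ a * c j)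
    (h : Tendsto (fun j => (∑ n ∈ Finset.Icc 1 (c j), v n) / c j) atTop (𝓝 0)) :
    Tendsto (fun N : ℕ => (∑ n ∈ Finset.Icc 1 N, v n) / N) atTop (𝓝 0) := by
  have hne : ∀ {d : ℕ → ℕ}, Tendsto d atTop atTop → ∀ w : ℕ → ℝ, ∀ᶠ j in atTop,
      (w (d j) + d j) / d j = w (d j) / d j + 1 := by
    intro d hd w
    filter_upwards [hd.eventually_gt_atTop 0] with j hj
    have : (d j : ℝ) ≠ 0 := by exact_mod_cast hj.ne'
    field_simp
  -- Since `|v n| ≤ 1`, adding `N` makes the partial sums monotone, so they can be interpolated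
  -- between the `c j`; the limit becomes `1`.
  have key := tendsto_div_of_monotone_of_exists_subseq_tendsto_div
    (fun N : ℕ => (∑ n ∈ Finset.Icc 1 N, v n) + N) 1 ?_ ?_
  · have h1 := (key.congr' (hne tendsto_id fun N => ∑ n ∈ Finset.Icc 1 N, v n)).sub_const 1
    simpa using h1
  · refine monotone_nat_of_le_succ fun N => ?_
    rw [Finset.sum_Icc_succ_top (by omega)]
    push_cast
    linarith [(abs_le.1 (hv (N + 1))).1]
  · intro a ha
    refine ⟨c, hratio a ha, hc, ?_⟩
    have := (h.add_const 1).congr' ((hne hc fun N => ∑ n ∈ Finset.Icc 1 N, v n).mono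
      fun j hj => hj.symm)
    simpa using this

theorem tendsto_average_of_subseq {v : ℕ → ℂ} (hv : ∀ n, ‖v n‖ ≤ 1) {c : ℕ → ℕ}
    (hc : Tendsto c atTop atTop)
    (hratio : ∀ a : ℝ, 1 < a → ∀ᶠ j in atTop, (c (j + 1) : ℝ) ≤ a * c j)
    (h : Tendsto (fun j => ‖∑ n ∈ Finset.Icc 1 (c j), v n‖ / c j) atTop (𝓝 0)) :
    Tendsto (fun N : ℕ => (N : ℂ)⁻¹ * ∑ n ∈ Finset.Icc 1 N, v n) atTop (𝓝 0) := by
  have hre := tendsto_average_of_subseq_real (v := fun n => (v n).re)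
    (fun n => (Complex.abs_re_le_norm _).trans (hv n)) hc hratio
    (squeeze_zero_norm (fun j => by
      rw [← Complex.re_sum, norm_div, Real.norm_natCast]
      exact div_le_div_of_nonneg_right (Complex.abs_re_le_norm _) (Nat.cast_nonneg _)) h)
  have him := tendsto_average_of_subseq_real (v := fun n => (v n).im)
    (fun n => (Complex.abs_im_le_norm _).trans (hv n)) hc hratio
    (squeeze_zero_norm (fun j => by
      rw [← Complex.im_sum, norm_div, Real.norm_natCast]
      exact div_le_div_of_nonneg_right (Complex.abs_im_le_norm _) (Nat.cast_nonneg _)) h)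
  have h1 := ((Complex.continuous_ofReal.tendsto _).comp hre).add
    (((Complex.continuous_ofReal.tendsto _).comp him).mul_const Complex.I)
  simp only [Complex.ofReal_zero, zero_mul, add_zero] at h1
  refine h1.congr fun N => ?_
  simp only [Function.comp_apply, ← Complex.re_sum, ← Complex.im_sum]
  push_cast
  conv_rhs => rw [← Complex.re_add_im (∑ n ∈ Finset.Icc 1 N, v n)]
  ring

theorem integral_norm_sum_sq_le {α β : ℝ} (hαβ : α ≤ β) {u : ℕ → ℝ → ℂ}
    (hu : ∀ n, Continuous (u n)) (hnorm : ∀ n x, ‖u n x‖ ≤ 1) (N : ℕ) :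
    ∫ x in α..β, ‖∑ n ∈ Finset.Icc 1 N, u n x‖ ^ 2 ≤ N * (β - α) +
      2 * ∑ n ∈ Finset.Icc 1 N, ∑ m ∈ Finset.Ico 1 n,
        ‖∫ x in α..β, u n x * starRingEnd ℂ (u m x)‖ := by
  induction N with
  | zero => simp
  | succ N ih =>
    have hS : Continuous fun x => ∑ n ∈ Finset.Icc 1 N, u n x := by fun_prop
    have hcross : Continuous fun x => u (N + 1) x * starRingEnd ℂ (∑ n ∈ Finset.Icc 1 N, u n x) :=
      (hu _).mul (Complex.continuous_conj.comp hS)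
    have hpt : ∀ x, ‖∑ n ∈ Finset.Icc 1 (N + 1), u n x‖ ^ 2 =
        ‖∑ n ∈ Finset.Icc 1 N, u n x‖ ^ 2 + ‖u (N + 1) x‖ ^ 2 +
          2 * (u (N + 1) x * starRingEnd ℂ (∑ n ∈ Finset.Icc 1 N, u n x)).re := by
      intro x
      rw [Finset.sum_Icc_succ_top (by omega), add_comm (∑ n ∈ Finset.Icc 1 N, u n x),
        ← Complex.normSq_eq_norm_sq, ← Complex.normSq_eq_norm_sq, ← Complex.normSq_eq_norm_sq,
        Complex.normSq_add]
      ring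
    simp_rw [hpt]
    have i1 : IntervalIntegrable (fun x => ‖∑ n ∈ Finset.Icc 1 N, u n x‖ ^ 2) volume α β :=
      (hS.norm.pow 2).intervalIntegrable _ _
    have i2 : IntervalIntegrable (fun x => ‖u (N + 1) x‖ ^ 2) volume α β :=
      ((hu _).norm.pow 2).intervalIntegrable _ _
    have i3 : IntervalIntegrable
        (fun x => 2 * (u (N + 1) x * starRingEnd ℂ (∑ n ∈ Finset.Icc 1 N, u n x)).re) volume α β :=
      (continuous_const.mul (Complex.continuous_re.comp hcross)).intervalIntegrable _ _
    rw [intervalIntegral.integral_add (i1.add i2) i3, intervalIntegral.integral_add i1 i2,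
      intervalIntegral.integral_const_mul, Finset.sum_Icc_succ_top (by omega)]
    have h2 : ∫ x in α..β, ‖u (N + 1) x‖ ^ 2 ≤ β - α := by
      have := intervalIntegral.integral_mono_on hαβ i2
        (intervalIntegrable_const (c := (1 : ℝ))) fun x _ => by
          simpa using pow_le_one₀ (n := 2) (norm_nonneg _) (hnorm (N + 1) x)
      simpa using this
    have h3 : ∫ x in α..β, (u (N + 1) x * starRingEnd ℂ (∑ n ∈ Finset.Icc 1 N, u n x)).re ≤
        ∑ m ∈ Finset.Ico 1 (N + 1), ‖∫ x in α..β, u (N + 1) x * starRingEnd ℂ (u m x)‖ := by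
      have e1 : ∫ x in α..β, (u (N + 1) x * starRingEnd ℂ (∑ n ∈ Finset.Icc 1 N, u n x)).re =
          (∫ x in α..β, u (N + 1) x * starRingEnd ℂ (∑ n ∈ Finset.Icc 1 N, u n x)).re :=
        Complex.reCLM.intervalIntegral_comp_comm (hcross.intervalIntegrable _ _)
      rw [e1]
      refine (Complex.re_le_norm _).trans ?_
      simp_rw [map_sum, Finset.mul_sum]
      rw [intervalIntegral.integral_finsetSum]
      · exact norm_sum_le _ _
      · intro m _
        exact ((hu _).mul (Complex.continuous_conj.comp (hu m))).intervalIntegrable _ _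
    push_cast
    linarith

theorem eventually_inv_le_inv_log_rpow (s : ℝ) :
    ∀ᶠ N : ℕ in atTop, 1 / (N : ℝ) ≤ 1 / (Real.log N) ^ s := by
  have h := (isLittleO_log_rpow_rpow_atTop s (one_pos)).bound (c := 1) one_pos
  filter_upwards [tendsto_natCast_atTop_atTop.eventually h, eventually_gt_atTop 1] with N hN hN1
  have hlog : 0 < Real.log N := Real.log_pos (by exact_mod_cast hN1)
  rw [one_mul, Real.rpow_one, Real.norm_natCast, Real.norm_of_nonneg (by positivity)] at hN
  exact one_div_le_one_div_of_le (by positivity) hN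

/-- The second moment bound under a scattering condition. -/
theorem exists_integral_norm_sum_sq_div_le {α β : ℝ} (hαβ : α ≤ β) {u : ℕ → ℝ → ℂ}
    (hu : ∀ n, Continuous (u n)) (hnorm : ∀ n x, ‖u n x‖ ≤ 1) {t : ℕ → ℕ → ℝ}
    (ht : ∀ n m, 0 ≤ t n m) {C : ℝ} {n0 : ℕ} (hC : 0 ≤ C)
    (h : ∀ n m, n0 < m → m < n → ‖∫ x in α..β, u n x * starRingEnd ℂ (u m x)‖ ≤ C * t n m)
    {s : ℝ} (hsum : ∀ᶠ N : ℕ in atTop,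
      (1 / (N : ℝ) ^ 2) * ∑ n ∈ Finset.Icc 1 N, ∑ m ∈ Finset.Ico 1 n, t n m
        ≤ 1 / (Real.log N) ^ s) :
    ∃ K : ℝ, ∀ᶠ N : ℕ in atTop,
      ∫ x in α..β, (‖∑ n ∈ Finset.Icc 1 N, u n x‖ / N) ^ 2 ≤ K / (Real.log N) ^ s := by
  have hL : 0 ≤ β - α := sub_nonneg.2 hαβ
  -- The diagonal gives `(β - α) N`; the pairs with `m ≤ n0`, bounded trivially, give at most `2 (β
  -- - α) n0 N`. After division by `N²` both are `O(1 / N)`, which is below `(log N)^(-s)`.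
  refine ⟨(β - α) * (1 + 2 * n0) + 2 * C, ?_⟩
  have hpair : ∀ n m, m < n → ‖∫ x in α..β, u n x * starRingEnd ℂ (u m x)‖ ≤
      C * t n m + if m ≤ n0 then (β - α) else 0 := by
    intro n m hmn
    by_cases hm : m ≤ n0
    · rw [if_pos hm]
      have h1 := intervalIntegral.norm_integral_le_of_norm_le_const (a := α) (b := β) (C := 1)
        (f := fun x => u n x * starRingEnd ℂ (u m x)) fun x _ => by
          rw [norm_mul, RCLike.norm_conj]
          exact mul_le_one₀ (hnorm n x) (norm_nonneg _) (hnorm m x)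
      rw [one_mul, abs_of_nonneg hL] at h1
      linarith [mul_nonneg hC (ht n m)]
    · rw [if_neg hm, add_zero]
      refine h n m ?_ hmn
      omega
  have hinner : ∀ n, ∑ m ∈ Finset.Ico 1 n, ‖∫ x in α..β, u n x * starRingEnd ℂ (u m x)‖ ≤
      C * (∑ m ∈ Finset.Ico 1 n, t n m) + (β - α) * n0 := by
    intro n
    refine (Finset.sum_le_sum fun m hm => hpair n m (Finset.mem_Ico.1 hm).2).trans ?_
    rw [Finset.sum_add_distrib, ← Finset.mul_sum, ← Finset.sum_filter, Finset.sum_const, nsmul_eq_mul,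
      mul_comm _ (β - α)]
    have hcard : ((Finset.Ico 1 n).filter fun m => m ≤ n0).card ≤ n0 := by
      have : ((Finset.Ico 1 n).filter fun m => m ≤ n0) ⊆
          Finset.Icc 1 n0 := by
        intro m hm
        simp only [Finset.mem_filter, Finset.mem_Ico, Finset.mem_Icc] at hm ⊢
        omega
      simpa using Finset.card_le_card this
    gcongr
  filter_upwards [hsum, eventually_inv_le_inv_log_rpow s, eventually_gt_atTop 0] with N h1 h2 hN
  have hN' : (0 : ℝ) < N := by exact_mod_cast hN
  have h3 := integral_norm_sum_sq_le hαβ hu hnorm N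
  have h4 := Finset.sum_le_sum fun n (_ : n ∈ Finset.Icc 1 N) => hinner n
  rw [Finset.sum_add_distrib, ← Finset.mul_sum, Finset.sum_const, Nat.card_Icc, nsmul_eq_mul,
    Nat.add_sub_cancel] at h4
  set Θ := ∑ n ∈ Finset.Icc 1 N, ∑ m ∈ Finset.Ico 1 n, t n m with hΘ
  have h5 : ∫ x in α..β, (‖∑ n ∈ Finset.Icc 1 N, u n x‖ / N) ^ 2 =
      1 / (N : ℝ) ^ 2 * ∫ x in α..β, ‖∑ n ∈ Finset.Icc 1 N, u n x‖ ^ 2 := by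
    rw [← intervalIntegral.integral_const_mul]
    congr 1
    funext x
    rw [div_pow]
    ring
  rw [h5]
  have h6 : ∫ x in α..β, ‖∑ n ∈ Finset.Icc 1 N, u n x‖ ^ 2 ≤
      (β - α) * (1 + 2 * n0) * N + 2 * C * Θ := by linarith
  calc 1 / (N : ℝ) ^ 2 * ∫ x in α..β, ‖∑ n ∈ Finset.Icc 1 N, u n x‖ ^ 2
      ≤ 1 / (N : ℝ) ^ 2 * ((β - α) * (1 + 2 * n0) * N + 2 * C * Θ) := by gcongr
    _ = (β - α) * (1 + 2 * n0) * (1 / N) + 2 * C * (1 / (N : ℝ) ^ 2 * Θ) := by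
        field_simp
    _ ≤ (β - α) * (1 + 2 * n0) * (1 / Real.log N ^ s) + 2 * C * (1 / Real.log N ^ s) := by gcongr
    _ = _ := by ring

/-- By monotone convergence `∑ F j` has finite integral, hence is finite almost everywhere, so its
terms tend to `0`. -/
theorem ae_tendsto_zero_of_summable_integral {μ : Measure ℝ} {F : ℕ → ℝ → ℝ}
    (hF : ∀ j, Integrable (F j) μ) (hF0 : ∀ j x, 0 ≤ F j x)
    (hsum : Summable fun j => ∫ x, F j x ∂μ) :
    ∀ᵐ x ∂μ, Tendsto (fun j => F j x) atTop (𝓝 0) := by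
  have h1 : ∫⁻ x, ∑' j, ENNReal.ofReal (F j x) ∂μ ≠ ⊤ := by
    rw [lintegral_tsum fun j => (hF j).1.aemeasurable.ennreal_ofReal]
    have : ∀ j, ∫⁻ x, ENNReal.ofReal (F j x) ∂μ = ENNReal.ofReal (∫ x, F j x ∂μ) := fun j =>
      (ofReal_integral_eq_lintegral_ofReal (hF j) (Eventually.of_forall (hF0 j))).symm
    simp_rw [this]
    exact hsum.tsum_ofReal_ne_top
  have h2 := ae_lt_top' (AEMeasurable.tsum fun j =>
    (hF j).1.aemeasurable.ennreal_ofReal) h1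
  filter_upwards [h2] with x hx
  have h3 := ENNReal.tendsto_atTop_zero_of_tsum_ne_top hx.ne
  have h4 := (ENNReal.tendsto_toReal ENNReal.zero_ne_top).comp h3
  simpa [Function.comp_def, ENNReal.toReal_ofReal (hF0 _ x)] using h4

/-- A Davenport–Erdős–LeVeque type criterion. -/
theorem ae_tendsto_average_zero {α β : ℝ} (hαβ : α ≤ β) {u : ℕ → ℝ → ℂ}
    (hu : ∀ n, Continuous (u n)) (hnorm : ∀ n x, ‖u n x‖ ≤ 1) {t : ℕ → ℕ → ℝ}
    (ht : ∀ n m, 0 ≤ t n m) {C : ℝ} {n0 : ℕ} (hC : 0 ≤ C)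
    (h : ∀ n m, n0 < m → m < n → ‖∫ x in α..β, u n x * starRingEnd ℂ (u m x)‖ ≤ C * t n m)
    {ε : ℝ} (hε : 0 < ε) (hsum : ∀ᶠ N : ℕ in atTop,
      (1 / (N : ℝ) ^ 2) * ∑ n ∈ Finset.Icc 1 N, ∑ m ∈ Finset.Ico 1 n, t n m
        ≤ 1 / (Real.log N) ^ (1 + ε)) :
    ∀ᵐ x ∂(volume.restrict (Set.Ioc α β)),
      Tendsto (fun N : ℕ => (N : ℂ)⁻¹ * ∑ n ∈ Finset.Icc 1 N, u n x) atTop (𝓝 0) := by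
  obtain ⟨K, hK⟩ := exists_integral_norm_sum_sq_div_le hαβ hu hnorm ht hC h hsum
  obtain ⟨c, s, hs, hc, hratio, hlog⟩ := exists_subexponential_subseq hε
  have hcont : ∀ j, Continuous fun x => (‖∑ n ∈ Finset.Icc 1 (c j), u n x‖ / c j) ^ 2 := by
    intro j; fun_prop
  have hsummable : Summable fun j => ∫ x, (‖∑ n ∈ Finset.Icc 1 (c j), u n x‖ / c j) ^ 2
      ∂(volume.restrict (Set.Ioc α β)) := by
    refine Summable.of_norm_bounded_eventually_nat (g := fun j : ℕ => |K| * (1 / (j : ℝ) ^ s))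
      ((Real.summable_one_div_nat_rpow.2 hs).mul_left _) ?_
    filter_upwards [hc.eventually hK, eventually_gt_atTop 0] with j hj hj0
    rw [intervalIntegral.integral_of_le hαβ] at hj
    rw [Real.norm_of_nonneg (integral_nonneg fun x => sq_nonneg _)]
    refine hj.trans ?_
    have hj0' : (0 : ℝ) < j := by exact_mod_cast hj0
    have hpos : 0 < (j : ℝ) ^ s := Real.rpow_pos_of_pos hj0' s
    have hle := hlog j
    rw [div_eq_mul_one_div]
    refine (mul_le_mul_of_nonneg_right (le_abs_self K) ?_).trans ?_
    · exact one_div_nonneg.2 (hpos.le.trans hle)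
    · gcongr
  have hae := ae_tendsto_zero_of_summable_integral (μ := volume.restrict (Set.Ioc α β))
    (fun j => ((hcont j).integrableOn_Icc (a := α) (b := β)).mono_set Set.Ioc_subset_Icc_self)
    (fun j x => sq_nonneg _) hsummable
  filter_upwards [hae] with x hx
  refine tendsto_average_of_subseq (fun n => hnorm n x) hc hratio ?_
  have := (Real.continuous_sqrt.tendsto _).comp hx
  rw [Real.sqrt_zero] at this
  refine this.congr fun j => ?_
  exact Real.sqrt_sq (by positivity)

/-! ### The exponential sums of the two sequences -/

theorem truncatedNegPow_nonneg (δ : ℝ) {t : ℝ} (ht : 0 ≤ t) : 0 ≤ truncatedNegPow δ t := by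
  unfold truncatedNegPow
  split_ifs
  · exact zero_le_one
  · exact le_min (Real.rpow_nonneg ht _) zero_le_one

/-- Merges the trivial bound, used for `t < 1` including `t = 0`, with the decay for `t ≥ 1`. -/
theorem le_mul_truncatedNegPow_half {K C t : ℝ} (ht : 0 ≤ t) (h1 : K ≤ C)
    (h2 : 1 ≤ t → K ≤ C / √t) : K ≤ C * truncatedNegPow (1 / 2) t := by
  rcases le_or_gt 1 t with h | h
  · have e : truncatedNegPow (1 / 2) t = 1 / √t := by
      have h3 : t ^ (-(1 / 2 : ℝ)) = 1 / √t := by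
        rw [Real.rpow_neg ht, ← Real.sqrt_eq_rpow, one_div]
      rw [truncatedNegPow, if_neg (by linarith), h3, min_eq_left]
      rw [div_le_one (by positivity)]
      exact Real.one_le_sqrt.2 h
    rw [e, mul_one_div]
    exact h2 h
  · have e : truncatedNegPow (1 / 2) t = 1 := by
      unfold truncatedNegPow
      split_ifs with h0
      · rfl
      · have h0' : 0 < t := lt_of_le_of_ne ht (Ne.symm h0)
        exact min_eq_right (Real.one_le_rpow_of_pos_of_le_one_of_nonpos h0' h.le (by norm_num))
    rw [e, mul_one]
    exact h1

/-- The unimodular function with phase `κ e ^ (b G) + l a f`. -/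
def expPhase (f G : ℝ → ℝ) (κ l b a : ℝ) (x : ℝ) : ℂ :=
  Complex.exp ((κ * Real.exp (b * G x) + l * a * f x : ℝ) * Complex.I)

theorem norm_expPhase (f G : ℝ → ℝ) (κ l b a x : ℝ) : ‖expPhase f G κ l b a x‖ = 1 :=
  Complex.norm_exp_ofReal_mul_I _

theorem continuous_expPhase {f G : ℝ → ℝ} (hf : Continuous f) (hG : Continuous G) (κ l b a : ℝ) :
    Continuous (expPhase f G κ l b a) := by
  unfold expPhase
  fun_prop

theorem expPhase_mul_conj (f G : ℝ → ℝ) (κ l b a b' a' x : ℝ) :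
    expPhase f G κ l b a x * starRingEnd ℂ (expPhase f G κ l b' a' x) =
      Complex.exp ((κ * (Real.exp (b * G x) - Real.exp (b' * G x)) + l * (a - a') * f x : ℝ) *
        Complex.I) := by
  unfold expPhase
  rw [← Complex.exp_conj, map_mul, Complex.conj_ofReal, Complex.conj_I, ← Complex.exp_add]
  congr 1
  push_cast
  ring

theorem norm_integral_expPhase_mul_conj_le {α β : ℝ} (hαβ : α ≤ β) (f G : ℝ → ℝ)
    (κ l b a b' a' : ℝ) :
    ‖∫ x in α..β, expPhase f G κ l b a x * starRingEnd ℂ (expPhase f G κ l b' a' x)‖ ≤ β - α := by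
  have h1 := intervalIntegral.norm_integral_le_of_norm_le_const (a := α) (b := β) (C := 1)
    (f := fun x => expPhase f G κ l b a x * starRingEnd ℂ (expPhase f G κ l b' a' x)) fun x _ => by
      rw [norm_mul, RCLike.norm_conj, norm_expPhase, norm_expPhase, one_mul]
  rwa [one_mul, abs_of_nonneg (sub_nonneg.2 hαβ)] at h1

theorem ae_tendsto_average_expPhase {α β : ℝ} (hαβ : α ≤ β) {f G : ℝ → ℝ}
    (hf : ContDiff ℝ 2 f) (hG : ContDiff ℝ 2 G) (hf' : ∀ x ∈ Set.Icc α β, deriv f x ≠ 0)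
    (hG' : ∀ x ∈ Set.Icc α β, deriv G x ≠ 0) (hG0 : ∀ x ∈ Set.Icc α β, 0 ≤ G x)
    {a b : ℕ → ℝ} (ha : DeltaScattered (1 / 2) a) (hb : DeltaScattered (1 / 2) b)
    (hb_top : Tendsto b atTop atTop) {κ l : ℝ} (hne : κ ≠ 0 ∨ l ≠ 0) :
    ∀ᵐ x ∂(volume.restrict (Set.Ioc α β)),
      Tendsto (fun N : ℕ => (N : ℂ)⁻¹ * ∑ n ∈ Finset.Icc 1 N, expPhase f G κ l (b n) (a n) x)
        atTop (𝓝 0) := by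
  have hL : 0 ≤ β - α := sub_nonneg.2 hαβ
  have hcont := fun n => continuous_expPhase hf.continuous hG.continuous κ l (b n) (a n)
  have hnorm := fun n x => (norm_expPhase f G κ l (b n) (a n) x).le
  -- Scattering of `a` is needed only for `κ = 0`. Otherwise the differences `a n - a m` enter only
  -- through the arbitrary coefficient `A`, and scattering of `b` suffices.
  by_cases hκ : κ = 0
  · have hl : l ≠ 0 := hne.resolve_left (not_not.2 hκ)
    obtain ⟨ε, hε, hsum⟩ := ha
    obtain ⟨C, hC⟩ := exists_norm_integral_exp_mul_le hαβ hf hf' hl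
    refine ae_tendsto_average_zero (t := fun n m => truncatedNegPow (1 / 2) |a n - a m|)
      (C := max C (β - α)) (n0 := 0) hαβ hcont hnorm
      (fun n m => truncatedNegPow_nonneg _ (abs_nonneg _)) (hL.trans (le_max_right _ _)) ?_ hε hsum
    intro n m _ _
    refine le_mul_truncatedNegPow_half (abs_nonneg _)
      ((norm_integral_expPhase_mul_conj_le hαβ _ _ _ _ _ _ _ _).trans (le_max_right _ _)) ?_
    intro h1
    have h2 := hC (a n - a m) h1
    simp_rw [expPhase_mul_conj, hκ, zero_mul, zero_add]
    exact h2.trans (by gcongr; exact le_max_left _ _)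
  · obtain ⟨ε, hε, hsum⟩ := hb
    obtain ⟨C1, B1, h1⟩ := exists_norm_integral_exp_sub_exp_le hαβ hf hG hf' hG' hG0 hκ
    -- `b` need not be monotone: when `b n < b m`, exchanging the two exponentials changes `κ` into
    -- `-κ`.
    obtain ⟨C2, B2, h2⟩ :=
      exists_norm_integral_exp_sub_exp_le hαβ hf hG hf' hG' hG0 (neg_ne_zero.2 hκ)
    obtain ⟨n0, hn0⟩ := eventually_atTop.1 (hb_top.eventually_ge_atTop (max B1 B2))
    have hB1 := fun n hn => (le_max_left B1 B2).trans (hn0 n hn)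
    have hB2 := fun n hn => (le_max_right B1 B2).trans (hn0 n hn)
    refine ae_tendsto_average_zero (t := fun n m => truncatedNegPow (1 / 2) |b n - b m|)
      (C := max (max C1 C2) (β - α)) (n0 := n0) hαβ hcont hnorm
      (fun n m => truncatedNegPow_nonneg _ (abs_nonneg _)) (hL.trans (le_max_right _ _)) ?_ hε hsum
    intro n m hm hmn
    refine le_mul_truncatedNegPow_half (abs_nonneg _)
      ((norm_integral_expPhase_mul_conj_le hαβ _ _ _ _ _ _ _ _).trans (le_max_right _ _)) ?_
    intro ht
    simp_rw [expPhase_mul_conj]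
    rcases lt_trichotomy (b m) (b n) with hlt | heq | hgt
    · rw [abs_of_pos (sub_pos.2 hlt)]
      refine (h1 (b n) (b m) (l * (a n - a m)) (hB1 m hm.le) hlt).trans ?_
      gcongr
      exact (le_max_left _ _).trans (le_max_left _ _)
    · rw [heq, sub_self, abs_zero] at ht
      linarith
    · rw [abs_of_neg (sub_neg.2 hgt), neg_sub]
      have h3 := h2 (b m) (b n) (l * (a n - a m)) (hB2 n (hm.trans hmn).le) hgt
      have e : ∀ x, -κ * (Real.exp (b m * G x) - Real.exp (b n * G x)) =
          κ * (Real.exp (b n * G x) - Real.exp (b m * G x)) := fun x => by ring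
      simp_rw [e] at h3
      refine h3.trans ?_
      gcongr
      exact (le_max_right _ _).trans (le_max_left _ _)

/-! ### Exceptional points and conclusion -/

/-- By the identity theorem the zeros of the derivative of a non-constant analytic function are
isolated, so their set is locally null. -/
theorem measure_deriv_eq_zero_of_analytic {f : ℝ → ℝ} (hf : AnalyticOnNhd ℝ f Set.univ)
    (hne : ∃ x y, f x ≠ f y) : volume {x | deriv f x = 0} = 0 := by
  have hex : ∃ x, deriv f x ≠ 0 := by
    by_contra! h
    obtain ⟨x, y, hxy⟩ := hne
    exact hxy (is_const_of_deriv_eq_zero (fun x => (hf x trivial).differentiableAt) h x y)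
  obtain ⟨x, hx⟩ := hex
  refine measure_null_of_locally_null _ fun y _ => ?_
  rcases (hf.deriv y trivial).eventually_eq_zero_or_eventually_ne_zero with h | h
  · exact absurd (hf.deriv.eqOn_zero_of_preconnected_of_eventuallyEq_zero isPreconnected_univ
      (Set.mem_univ y) h (Set.mem_univ x)) hx
  · refine ⟨{x | deriv f x = 0} ∩ {z | z ≠ y → deriv f z ≠ 0},
      inter_mem_nhdsWithin _ (eventually_nhdsWithin_iff.1 h), ?_⟩
    refine measure_mono_null (t := {y}) ?_ (measure_singleton y)
    rintro z ⟨hz1, hz2⟩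
    by_contra hzy
    exact hz2 hzy hz1

theorem mFourier_coe_pair (n : Fin 2 → ℤ) (f G : ℝ → ℝ) (a b x : ℝ) :
    UnitAddTorus.mFourier n
      (fun i => ((![Real.exp (b * G x), a * f x] i : ℝ) : UnitAddCircle)) =
      expPhase f G (2 * Real.pi * n 0) (2 * Real.pi * n 1) b a x := by
  simp only [UnitAddTorus.mFourier, ContinuousMap.coe_mk, Fin.prod_univ_two, expPhase,
    fourier_coe_apply, Matrix.cons_val_zero, Matrix.cons_val_one]
  rw [← Complex.exp_add]
  congr 1
  push_cast
  ring

theorem ae_uniformlyDistributed_Ioc {α β : ℝ} (hαβ : α ≤ β) {f G : ℝ → ℝ}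
    (hf : ContDiff ℝ 2 f) (hG : ContDiff ℝ 2 G) (hf' : ∀ x ∈ Set.Icc α β, deriv f x ≠ 0)
    (hG' : ∀ x ∈ Set.Icc α β, deriv G x ≠ 0) (hG0 : ∀ x ∈ Set.Icc α β, 0 ≤ G x)
    {a b : ℕ → ℝ} (ha : DeltaScattered (1 / 2) a) (hb : DeltaScattered (1 / 2) b)
    (hb_top : Tendsto b atTop atTop) :
    ∀ᵐ x ∂(volume.restrict (Set.Ioc α β)),
      UniformlyDistributedModOne (fun n : ℕ => ![Real.exp (b n * G x), a n * f x]) := by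
  have h : ∀ᵐ x ∂(volume.restrict (Set.Ioc α β)), ∀ n : Fin 2 → ℤ, n ≠ 0 →
      Tendsto (fun N : ℕ => (N : ℂ)⁻¹ * ∑ j ∈ Finset.Icc 1 N,
        expPhase f G (2 * Real.pi * n 0) (2 * Real.pi * n 1) (b j) (a j) x) atTop (𝓝 0) := by
    refine ae_all_iff.2 fun n => ?_
    by_cases hn : n = 0
    · exact Eventually.of_forall fun x h => absurd hn h
    have hne : (2 * Real.pi * n 0 : ℝ) ≠ 0 ∨ (2 * Real.pi * n 1 : ℝ) ≠ 0 := by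
      by_contra! h
      have hpi : (2 * Real.pi : ℝ) ≠ 0 := by positivity
      apply hn
      funext i
      fin_cases i
      · exact_mod_cast (mul_eq_zero.1 h.1).resolve_left hpi
      · exact_mod_cast (mul_eq_zero.1 h.2).resolve_left hpi
    filter_upwards [ae_tendsto_average_expPhase hαβ hf hG hf' hG' hG0 ha hb hb_top hne] with x hx _
    exact hx
  filter_upwards [h] with x hx
  refine uniformlyDistributedModOne_of_weyl fun n hn => ?_
  simp_rw [mFourier_coe_pair]
  exact hx n hn

end

theorem mainTheorem9 (f g : ℝ → ℝ)
    (hf : AnalyticOnNhd ℝ f Set.univ) (hf_nonconst : ∃ x y, f x ≠ f y)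
    (hg : AnalyticOnNhd ℝ g Set.univ) (hg_nonconst : ∃ x y, g x ≠ g y)
    (hg_range : Set.range g ⊆ Set.Ioi 1)
    (a b : ℕ → ℝ) (ha : Scattered a) (hb : Scattered b) (hb_top : Tendsto b atTop atTop) :
    ∀ᵐ x ∂(volume : Measure ℝ),
      UniformlyDistributedModOne (fun n : ℕ => ![g x ^ b n, a n * f x]) := by
  have hhalf : (1 / 2 : ℝ) ∈ Set.Ioc (0 : ℝ) 1 := by norm_num
  have hg1 : ∀ x, 1 < g x := fun x => hg_range ⟨x, rfl⟩
  have hg0 : ∀ x, g x ≠ 0 := fun x => by linarith [hg1 x]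
  have cf : ContDiff ℝ 2 f := hf.contDiff
  have cg : ContDiff ℝ 2 g := hg.contDiff
  have cG : ContDiff ℝ 2 (fun x => Real.log (g x)) := cg.log hg0
  have hpow : ∀ x n, g x ^ b n = Real.exp (b n * Real.log (g x)) := fun x n => by
    rw [Real.rpow_def_of_pos (by linarith [hg1 x]), mul_comm]
  simp_rw [hpow]
  have hZ : ∀ᵐ x : ℝ, deriv f x ≠ 0 ∧ deriv g x ≠ 0 :=
    (measure_eq_zero_iff_ae_notMem.1 (measure_deriv_eq_zero_of_analytic hf hf_nonconst)).and
      (measure_eq_zero_iff_ae_notMem.1 (measure_deriv_eq_zero_of_analytic hg hg_nonconst))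
  set good : Set ℝ := {x | UniformlyDistributedModOne
    (fun n : ℕ => ![Real.exp (b n * Real.log (g x)), a n * f x])} with hgood
  -- Each point of the open set where `f'` and `g'` do not vanish has a closed interval around it
  -- inside that set, on which the local theorem applies; locally null sets are null.
  have hlocal : volume ({x | deriv f x ≠ 0 ∧ deriv g x ≠ 0} ∩ goodᶜ) = 0 := by
    refine measure_null_of_locally_null _ fun x₀ hx₀ => ?_
    have hopen : IsOpen {x | deriv f x ≠ 0 ∧ deriv g x ≠ 0} :=
      (isOpen_ne_fun (hasDerivAt_deriv_of_contDiff cf 0).2.2.1 continuous_const).inter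
        (isOpen_ne_fun (hasDerivAt_deriv_of_contDiff cg 0).2.2.1 continuous_const)
    obtain ⟨r, hr, hball⟩ := Metric.nhds_basis_closedBall.mem_iff.1 (hopen.mem_nhds hx₀.1)
    rw [Real.closedBall_eq_Icc] at hball
    have hae := ae_uniformlyDistributed_Ioc (α := x₀ - r) (β := x₀ + r) (by linarith) cf cG
      (fun x hx => (hball hx).1)
      (fun x hx => by
        rw [deriv.log (cg.differentiable (by norm_num) x) (hg0 x)]
        exact div_ne_zero (hball hx).2 (hg0 x))
      (fun x _ => Real.log_nonneg (hg1 x).le) (ha _ hhalf) (hb _ hhalf) hb_top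
    refine ⟨Set.Ioc (x₀ - r) (x₀ + r) ∩ goodᶜ, ?_, ?_⟩
    · refine mem_nhdsWithin.2 ⟨Set.Ioo (x₀ - r) (x₀ + r), isOpen_Ioo, by constructor <;> linarith, ?_⟩
      exact fun x hx => ⟨Set.Ioo_subset_Ioc_self hx.1, hx.2.2⟩
    · rw [ae_restrict_iff' measurableSet_Ioc] at hae
      refine measure_mono_null ?_ hae
      intro x hx h
      exact hx.2 (h hx.1)
  filter_upwards [hZ, measure_eq_zero_iff_ae_notMem.1 hlocal] with x hx1 hx2
  by_contra h
  exact hx2 ⟨hx1, h⟩
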